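/- **Theorem A.** Let $T>0$ and let $p:\mathbb R\to\mathbb R$ be a $T$-periodic function, Lebesgue integrable on $[0,T]$, with $\frac1T\int_0^T p(s)\,ds=0$. Consider the system $$\phi'=1,\qquad x'=y,\qquad y'=-\operatorname{sign}(x)+p(\phi)$$ on $\mathbb S^1\times\mathbb R^2$, where $\mathbb S^1=\mathbb R/T\mathbb Z$. Solutions are absolutely continuous curves satisfying the equations for almost every time, where $\operatorname{sign}(0)$ may be any number in $[-1,1]$ (Filippov's convention). Then there is a sequence $(\mathbb T_n)_{n\in\mathbb N}$ of invariant tori in $\mathbb S^1\times\mathbb R^2$; here a torus is a subset homeomorphic to $\mathbb S^1\times\mathbb S^1$ by a homeomorphism over the first factor $\mathbb S^1\ni\phi$ (so each time section is a simple closed curve), and it is invariant if every solution, on any interval, that meets it stays in it as long as it is defined. Let $\mathrm{int}(\mathbb T_n)$ denote the region enclosed by $\mathbb T_n$, i.e. the union of the bounded connected components of the complement of $\mathbb T_n$. The following hold. 1. The tori are nested: $\mathbb T_n\cup\mathrm{int}(\mathbb T_n)\subset\mathrm{int}(\mathbb T_{n+1})$ for every $n\in\mathbb N$. 2. $\mathbb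 S^1\times\mathbb R^2=\bigcup_{n\in\mathbb N}\mathrm{int}(\mathbb T_n)$. 3. For each $n\in\mathbb N$, the torus $\mathbb T_n$ is foliated by periodic solutions: there is a homeomorphism from $\mathbb S^1\times\mathbb S^1$ onto $\mathbb T_n$ that maps each circle $\{c\}\times\mathbb S^1$ onto the orbit of a periodic solution, and this solution has $x(t)\neq0$ for almost every $t$. -/

import Mathlib

open MeasureTheory

namespace NonsmoothOscillator

/-- The phase space `S¹ × ℝ²` with `S¹ = ℝ / Tℤ`; a point is `(φ, x, y)`. -/
abbrev Phase (T : ℝ) : Type := AddCircle T × ℝ × ℝ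

/-- The values that `sign x` may take in the equation: `1` for `x > 0`, `-1` for `x < 0`, and
(Filippov's convention on the switching plane) any number of `[-1, 1]` for `x = 0`. -/
def signSet (x : ℝ) : Set ℝ :=
  {s | (0 < x → s = 1) ∧ (x < 0 → s = -1) ∧ s ∈ Set.Icc (-1 : ℝ) 1}

/-- `(φ, x, y)` is a (Carathéodory–Filippov) solution of
`φ' = 1, x' = y, y' = -sign(x) + p(φ)` on the interval `I`, in the extended phase space `ℝ × ℝ²`:
the components are absolutely continuous on the compact subintervals of `I`, and the equations hold
at almost every time. -/
structure IsSolutionOn (p : ℝ → ℝ) (I : Set ℝ) (φ x y : ℝ → ℝ) : Prop where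
  ac_phase : ∀ a ∈ I, ∀ b ∈ I, AbsolutelyContinuousOnInterval φ a b
  ac_pos : ∀ a ∈ I, ∀ b ∈ I, AbsolutelyContinuousOnInterval x a b
  ac_vel : ∀ a ∈ I, ∀ b ∈ I, AbsolutelyContinuousOnInterval y a b
  eqn_phase : ∀ᵐ t : ℝ, t ∈ I → HasDerivAt φ 1 t
  eqn_pos : ∀ᵐ t : ℝ, t ∈ I → HasDerivAt x (y t) t
  eqn_vel : ∀ᵐ t : ℝ, t ∈ I → ∃ s ∈ signSet (x t), HasDerivAt y (-s + p (φ t)) t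

/-- The curve in the quotient `S¹ × ℝ²` given by a curve in `ℝ × ℝ²`. -/
def curve (T : ℝ) (φ x y : ℝ → ℝ) (t : ℝ) : Phase T :=
  ((φ t : AddCircle T), x t, y t)

/-- `K` is invariant: a solution, on any interval, that meets `K` stays in `K` (forward and
backward in time) as long as it is defined. -/
def IsInvariant (T : ℝ) (p : ℝ → ℝ) (K : Set (Phase T)) : Prop :=
  ∀ (I : Set ℝ) (φ x y : ℝ → ℝ), I.OrdConnected → IsSolutionOn p I φ x y →
    ∀ t₀ ∈ I, curve T φ x y t₀ ∈ K → ∀ t ∈ I, curve T φ x y t ∈ K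

/-- `K` is a torus in `S¹ × ℝ²` that projects to the circle of times with closed curves as fibres:
it is homeomorphic to `S¹ × S¹` over the first factor. Equivalently, it is the quotient of a
cylinder in `ℝ × ℝ²` that is invariant under the translation of `φ` by `T`. -/
def IsTorus (T : ℝ) (K : Set (Phase T)) : Prop :=
  ∃ h : (AddCircle T × Circle) ≃ₜ K, ∀ (θ : AddCircle T) (c : Circle), (h (θ, c) : Phase T).1 = θ

/-- The region enclosed by `K`: the union of the bounded connected components of the complement. -/
def enclosed (T : ℝ) (K : Set (Phase T)) : Set (Phase T) :=
  {z | z ∉ K ∧ Bornology.IsBounded (connectedComponentIn Kᶜ z)}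

/-- `L` is the orbit, in `S¹ × ℝ²`, of a periodic solution defined for all times. The solution
crosses the switching plane `x = 0` only at a null set of times, so that it satisfies
`y' = -sign(x) + p(φ)` almost everywhere whatever the value of `sign 0`. -/
def IsPeriodicOrbit (T : ℝ) (p : ℝ → ℝ) (L : Set (Phase T)) : Prop :=
  ∃ φ x y : ℝ → ℝ, IsSolutionOn p Set.univ φ x y ∧ (∀ᵐ t : ℝ, x t ≠ 0) ∧
    (∃ τ : ℝ, 0 < τ ∧ Function.Periodic (curve T φ x y) τ) ∧
    L = Set.range (curve T φ x y)

/-- The torus `K` is foliated by periodic solutions: a homeomorphism of `S¹ × S¹` onto `K` carries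
each circle `{c} × S¹` onto the orbit of a periodic solution. -/
def IsFoliatedByPeriodicSolutions (T : ℝ) (p : ℝ → ℝ) (K : Set (Phase T)) : Prop :=
  ∃ h : (Circle × Circle) ≃ₜ K, ∀ c : Circle,
    IsPeriodicOrbit T p (Set.range fun d : Circle => (h (c, d) : Phase T))

end NonsmoothOscillator

/-!
The tori are explicit. Let `r` and `q` be the `T`-periodic first and second primitives of `p`,
the former with mean value zero, so that `q'' = p`, and let `u` be the solution of `u'' = -sign u`
with `u 0 = 0`, `u' 0 = a`: it is periodic of period `4a`, and
`u σ = σ (2a - |σ|) / 2` for `|σ| ≤ 2a`. If `2a` is a multiple of `T`, then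
`x t = q t - q t₀ + u (t - t₀)` vanishes at `t₀`, `t₀ + 2a`, `t₀ + 4a`, …. In between, the periodic
term `q t - q t₀` is at most `L` times the distance to the nearest of these times, where `L` bounds
`r = q'`, so it is dominated by `u` once `a > 2L` (`abs_sub_lt_of_isResonant`). Then `x` has the
sign of `u`, and it is a periodic solution for every `t₀` (`isSolutionOn_position`).

The torus of parameter `a` is the union of these orbits, parametrized by `t` modulo `T` and
`σ = t - t₀` modulo `4a`. At each phase, the velocity `r t + a - |σ|` and the sign of `x`
determine `σ` (`injective_torusMap`), and fixing `t₀` modulo `T` gives the foliation. Over each phase, the torus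
consists of two graphs over the velocity, an upper and a lower one, which meet at the two extreme
velocities (`range_torusMap`). Its complement is thus the bounded open set between the graphs and
the set outside, from each point of which a horizontal ray escapes to infinity; so the enclosed
region is known without the Jordan curve theorem (`enclosed_torus`). Nesting and exhaustion follow
by comparing graphs, since `q` is `L`-Lipschitz and bounded.

The torus is invariant because its orbits cross `x = 0` with nonzero velocity, where a solution in
the sense of Filippov is unique (`eq_of_transversal`): on either side of the crossing time, the
position has a definite sign, and so the equation has only one value of the sign.
-/

namespace NonsmoothOscillator

/-! ### The free oscillation -/

/-- The velocity of the free oscillation `u'' = -sign u` of amplitude `a²/2`: the triangle wave of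
period `4a` that equals `a - |σ|` for `|σ| ≤ 2a`. -/
noncomputable def wave (a σ : ℝ) : ℝ := a - ‖(σ : AddCircle (4 * a))‖

/-- The free oscillation `u'' = -sign u` that starts from `0` with velocity `a`. -/
noncomputable def wavePrim (a σ : ℝ) : ℝ := ∫ s in (0 : ℝ)..σ, wave a s

lemma continuous_wave (a : ℝ) : Continuous (wave a) :=
  continuous_const.sub (AddCircle.continuous_mk' (4 * a)).norm

lemma wave_of_abs_le {a σ : ℝ} (ha : 0 < a) (h : |σ| ≤ 2 * a) : wave a σ = a - |σ| := by
  rw [wave, (AddCircle.norm_coe_eq_abs_iff (4 * a) (by positivity)).2]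
  rw [abs_of_pos (by positivity : 0 < 4 * a)]
  linarith

lemma periodic_wave (a : ℝ) : Function.Periodic (wave a) (4 * a) := fun σ => by
  rw [wave, AddCircle.coe_add_period, wave]

lemma lipschitzWith_wave (a : ℝ) : LipschitzWith 1 (wave a) := by
  refine LipschitzWith.of_dist_le_mul fun s t => ?_
  rw [Real.dist_eq, Real.dist_eq, wave, wave, NNReal.coe_one, one_mul, sub_sub_sub_cancel_left,
    abs_sub_comm]
  refine (abs_norm_sub_norm_le _ _).trans ?_
  rw [← AddCircle.coe_sub]
  exact QuotientAddGroup.norm_mk_le_norm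

lemma hasDerivAt_wavePrim (a σ : ℝ) : HasDerivAt (wavePrim a) (wave a σ) σ :=
  intervalIntegral.integral_hasDerivAt_right ((continuous_wave a).intervalIntegrable _ _)
    ((continuous_wave a).stronglyMeasurableAtFilter _ _) (continuous_wave a).continuousAt

lemma wavePrim_of_abs_le {a σ : ℝ} (ha : 0 < a) (h : |σ| ≤ 2 * a) :
    wavePrim a σ = σ * (2 * a - |σ|) / 2 := by
  rw [wavePrim]
  rcases le_total 0 σ with h0 | h0
  · rw [intervalIntegral.integral_congr (g := fun s => a - s)]
    · rw [intervalIntegral.integral_sub (by simp) (by simp), abs_of_nonneg h0]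
      simp; ring
    · intro s hs
      rw [Set.uIcc_of_le h0] at hs
      have h1 : |s| ≤ 2 * a := (abs_le_abs_of_nonneg hs.1 hs.2).trans h
      simp [wave_of_abs_le ha h1, abs_of_nonneg hs.1]
  · rw [intervalIntegral.integral_congr (g := fun s => a + s)]
    · rw [intervalIntegral.integral_add (by simp) (by simp), abs_of_nonpos h0]
      simp; ring
    · intro s hs
      rw [Set.uIcc_of_ge h0] at hs
      have h1 : |s| ≤ 2 * a := by
        rw [abs_of_nonpos h0] at h; rw [abs_of_nonpos hs.2]; linarith [hs.1]
      simp [wave_of_abs_le ha h1, abs_of_nonpos hs.2]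

lemma periodic_wavePrim {a : ℝ} (ha : 0 < a) : Function.Periodic (wavePrim a) (4 * a) := by
  have hi := fun s t => (continuous_wave a).intervalIntegrable (μ := volume) s t
  intro σ
  have h1 : wavePrim a (σ + 4 * a) - wavePrim a σ = 0 := by
    have h2 : wavePrim a (-(2 * a) + 4 * a) - wavePrim a (-(2 * a)) = 0 := by
      have e1 : |2 * a| = 2 * a := abs_of_pos (by positivity)
      rw [show -(2 * a) + 4 * a = 2 * a by ring, wavePrim_of_abs_le ha e1.le,
        wavePrim_of_abs_le ha (by rw [abs_neg, e1]), abs_neg, e1]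
      ring
    rw [← h2]
    simp only [wavePrim]
    rw [intervalIntegral.integral_interval_sub_left (hi _ _) (hi _ _),
      intervalIntegral.integral_interval_sub_left (hi _ _) (hi _ _)]
    exact (periodic_wave a).intervalIntegral_add_eq _ _
  linarith

lemma hasDerivAt_wave_of_pos {a σ : ℝ} (h0 : 0 < σ) (h : σ < 2 * a) :
    HasDerivAt (wave a) (-1) σ := by
  have h1 : HasDerivAt (fun s : ℝ => a - s) (-1) σ := by
    simpa using (hasDerivAt_id σ).const_sub a
  refine h1.congr_of_eventuallyEq ?_
  filter_upwards [Ioo_mem_nhds h0 h] with s hs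
  rw [wave_of_abs_le (by linarith) (by rw [abs_of_pos hs.1]; exact hs.2.le), abs_of_pos hs.1]

lemma hasDerivAt_wave_of_neg {a σ : ℝ} (h0 : σ < 0) (h : -(2 * a) < σ) :
    HasDerivAt (wave a) 1 σ := by
  have h1 : HasDerivAt (fun s : ℝ => a + s) 1 σ := by
    simpa using (hasDerivAt_id σ).const_add a
  refine h1.congr_of_eventuallyEq ?_
  filter_upwards [Ioo_mem_nhds h h0] with s hs
  rw [wave_of_abs_le (by linarith) (by rw [abs_of_neg hs.2]; linarith [hs.1]), abs_of_neg hs.2]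
  ring

lemma exists_eq_add_period {a : ℝ} (ha : 0 < a) (σ : ℝ) :
    ∃ σ₀ ∈ Set.Ioc (-(2 * a)) (2 * a), ∃ k : ℤ, σ = σ₀ + k * (4 * a) := by
  obtain ⟨m, hm, -⟩ := existsUnique_add_zsmul_mem_Ioc (show 0 < 4 * a by positivity) σ (-(2 * a))
  refine ⟨σ + m • (4 * a), ?_, -m, ?_⟩
  · rwa [show -(2 * a) + 4 * a = 2 * a by ring] at hm
  · simp

/-! ### Periodic primitives of the forcing -/

/-- `r` and `q` are the periodic first and second primitives of the `T`-periodic forcing `p`, and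
`L` bounds `r`. -/
structure IsPeriodicPrimitive (T : ℝ) (p r q : ℝ → ℝ) (L : ℝ) : Prop where
  pos : 0 < T
  integrable : ∀ s t, IntervalIntegrable p volume s t
  vel_eq : ∀ s t, r t = r s + ∫ u in s..t, p u
  periodic_vel : Function.Periodic r T
  bound : ∀ t, |r t| ≤ L
  hasDerivAt_pos : ∀ t, HasDerivAt q (r t) t
  periodic_pos : Function.Periodic q T

lemma exists_isPeriodicPrimitive {T : ℝ} (hT : 0 < T) {p : ℝ → ℝ} (hper : Function.Periodic p T)
    (hint : IntervalIntegrable p volume 0 T) (havg : ∫ t in (0 : ℝ)..T, p t = 0) :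
    ∃ r q L, IsPeriodicPrimitive T p r q L := by
  have hp := hper.intervalIntegrable₀ hT.ne' hint
  set P : ℝ → ℝ := fun t => ∫ s in (0 : ℝ)..t, p s with hP
  have hPper : Function.Periodic P T := fun t => by
    have h1 := hper.intervalIntegral_add_eq t 0
    rw [zero_add, havg] at h1
    have h2 := intervalIntegral.integral_add_adjacent_intervals (hp 0 t) (hp t (t + T))
    simp only [hP]
    rw [← h2, h1, add_zero]
  have hPc : Continuous P := intervalIntegral.continuous_primitive hp 0
  set c := T⁻¹ * ∫ s in (0 : ℝ)..T, P s with hc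
  set r : ℝ → ℝ := fun t => P t - c with hr
  have hrc : Continuous r := hPc.sub continuous_const
  have hrper : Function.Periodic r T := fun t => by simp only [hr, hPper t]
  have hri := fun s t => hrc.intervalIntegrable (μ := volume) s t
  have hr0 : ∫ t in (0 : ℝ)..T, r t = 0 := by
    simp only [hr]
    rw [intervalIntegral.integral_sub (hPc.intervalIntegrable _ _) (by simp)]
    simp [hc, hT.ne']
  obtain ⟨L, hL⟩ := (isCompact_Icc (a := (0 : ℝ)) (b := T)).exists_bound_of_continuousOn
    hrc.continuousOn
  refine ⟨r, fun t => ∫ s in (0 : ℝ)..t, r s, L, hT, hp, fun s t => ?_, hrper, fun t => ?_,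
    fun t => ?_, fun t => ?_⟩
  · simp only [hr, hP]
    rw [← intervalIntegral.integral_add_adjacent_intervals (hp 0 s) (hp s t)]
    ring
  · obtain ⟨y, hy, hty⟩ := hrper.exists_mem_Ico₀ hT t
    rw [hty]
    exact hL y ⟨hy.1, hy.2.le⟩
  · exact intervalIntegral.integral_hasDerivAt_right (hri _ _) (hrc.stronglyMeasurableAtFilter _ _)
      hrc.continuousAt
  · have h1 := hrper.intervalIntegral_add_eq t 0
    rw [zero_add, hr0] at h1
    have h2 := intervalIntegral.integral_add_adjacent_intervals (hri 0 t) (hri t (t + T))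
    rw [← h2, h1, add_zero]

namespace IsPeriodicPrimitive

variable {T : ℝ} {p r q : ℝ → ℝ} {L : ℝ}

lemma continuous_pos (H : IsPeriodicPrimitive T p r q L) : Continuous q :=
  continuous_iff_continuousAt.2 fun t => (H.hasDerivAt_pos t).continuousAt

lemma continuous_vel (H : IsPeriodicPrimitive T p r q L) : Continuous r := by
  have h : r = fun t => r 0 + ∫ u in (0 : ℝ)..t, p u := funext fun t => H.vel_eq 0 t
  rw [h]
  exact continuous_const.add (intervalIntegral.continuous_primitive H.integrable 0)

lemma bound_nonneg (H : IsPeriodicPrimitive T p r q L) : 0 ≤ L :=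
  (abs_nonneg _).trans (H.bound 0)

lemma abs_sub_le (H : IsPeriodicPrimitive T p r q L) (s t : ℝ) : |q t - q s| ≤ L * |t - s| :=
  convex_univ.norm_image_sub_le_of_norm_hasDerivWithin_le (f := q) (f' := r)
    (fun u _ => (H.hasDerivAt_pos u).hasDerivWithinAt) (fun u _ => H.bound u)
    (Set.mem_univ s) (Set.mem_univ t)

/-- The translates of the velocity, written as integrals over intervals that start at `0`. -/
lemma vel_add_eq (H : IsPeriodicPrimitive T p r q L) (b : ℝ) :
    (fun t => r (t + b)) = fun t => r b + ∫ u in (0 : ℝ)..t, p (u + b) := by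
  funext t
  rw [intervalIntegral.integral_comp_add_right, zero_add]
  exact H.vel_eq b (t + b)

lemma integrable_add (H : IsPeriodicPrimitive T p r q L) (b s t : ℝ) :
    IntervalIntegrable (fun u => p (u + b)) volume s t := by
  simpa using (H.integrable (s + b) (t + b)).comp_add_right b

lemma ac_vel_add (H : IsPeriodicPrimitive T p r q L) (b s t : ℝ) :
    AbsolutelyContinuousOnInterval (fun t => r (t + b)) s t := by
  have h : (fun t => r (t + b)) = fun t => r (s + b) + ∫ u in s..t, p (u + b) := by
    funext t
    rw [intervalIntegral.integral_comp_add_right]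
    exact H.vel_eq _ _
  rw [h]
  refine AbsolutelyContinuousOnInterval.fun_add ?_
    ((H.integrable_add b s t).absolutelyContinuousOnInterval_intervalIntegral (by simp))
  exact (LipschitzWith.const (r (s + b))).lipschitzOnWith.absolutelyContinuousOnInterval

lemma ae_hasDerivAt_vel_add (H : IsPeriodicPrimitive T p r q L) (b : ℝ) :
    ∀ᵐ t : ℝ, HasDerivAt (fun t => r (t + b)) (p (t + b)) t := by
  have hli : LocallyIntegrable (fun u => p (u + b)) volume := by
    rw [locallyIntegrable_iff]
    intro K hK
    obtain ⟨R, hR⟩ := hK.isBounded.subset_closedBall 0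
    rw [Real.closedBall_eq_Icc] at hR
    refine IntegrableOn.mono_set ?_ hR
    rcases le_total 0 R with h0 | h0
    · exact (intervalIntegrable_iff_integrableOn_Icc_of_le (by linarith)).1 (H.integrable_add b _ _)
    · rcases h0.eq_or_lt with rfl | h0
      · simp
      · rw [Set.Icc_eq_empty (by linarith)]; exact integrableOn_empty
  filter_upwards [LocallyIntegrable.ae_hasDerivAt_integral hli] with t ht
  rw [H.vel_add_eq b]
  exact (ht 0).const_add _

end IsPeriodicPrimitive

/-! ### Uniqueness of transversal solutions -/

lemma IsSolutionOn.mono {p : ℝ → ℝ} {I J : Set ℝ} {φ x y : ℝ → ℝ} (h : IsSolutionOn p I φ x y)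
    (hJ : J ⊆ I) : IsSolutionOn p J φ x y where
  ac_phase a ha b hb := h.ac_phase a (hJ ha) b (hJ hb)
  ac_pos a ha b hb := h.ac_pos a (hJ ha) b (hJ hb)
  ac_vel a ha b hb := h.ac_vel a (hJ ha) b (hJ hb)
  eqn_phase := h.eqn_phase.mono fun _ ht hJt => ht (hJ hJt)
  eqn_pos := h.eqn_pos.mono fun _ ht hJt => ht (hJ hJt)
  eqn_vel := h.eqn_vel.mono fun _ ht hJt => ht (hJ hJt)

/-- Two absolutely continuous functions with the same derivative almost everywhere that agree at
one end of an interval agree at the other end. -/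
lemma eq_of_ae_hasDerivAt_eq {f g : ℝ → ℝ} {s t : ℝ} (hf : AbsolutelyContinuousOnInterval f s t)
    (hg : AbsolutelyContinuousOnInterval g s t)
    (hfg : ∀ᵐ u : ℝ, u ∈ Set.uIcc s t → ∃ d, HasDerivAt f d u ∧ HasDerivAt g d u)
    (h0 : f s = g s) : f t = g t := by
  obtain ⟨C, hC⟩ := (hf.sub hg).const_of_ae_hasDerivAt_zero (by
    filter_upwards [hfg] with u hu hut
    obtain ⟨d, h1, h2⟩ := hu hut
    simpa using h1.sub h2)
  have h1 := hC s Set.left_mem_uIcc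
  have h2 := hC t Set.right_mem_uIcc
  simp only [Pi.sub_apply] at h1 h2
  linarith

lemma IsSolutionOn.phase_eq {p : ℝ → ℝ} {I : Set ℝ} {φ x y : ℝ → ℝ} (hI : I.OrdConnected)
    (h : IsSolutionOn p I φ x y) {s t : ℝ} (hs : s ∈ I) (ht : t ∈ I) : φ t = t + (φ s - s) := by
  refine eq_of_ae_hasDerivAt_eq (g := fun u => u + (φ s - s)) (h.ac_phase s hs t ht) ?_ ?_ (by ring)
  · exact
      (LipschitzWith.id.add (LipschitzWith.const _)).lipschitzOnWith.absolutelyContinuousOnInterval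
  · filter_upwards [h.eqn_phase] with u hu hut
    exact ⟨1, hu (hI.uIcc_subset hs ht hut), (hasDerivAt_id u).add_const _⟩

lemma sub_mul_sub_pos_of_hasDerivAt_pos {x y : ℝ → ℝ} {s t : ℝ}
    (hx : AbsolutelyContinuousOnInterval x s t) (hy : ContinuousOn y (Set.uIcc s t))
    (hd : ∀ᵐ u : ℝ, u ∈ Set.uIcc s t → HasDerivAt x (y u) u) (hpos : ∀ u ∈ Set.uIcc s t, 0 < y u)
    (hst : s ≠ t) : 0 < (x t - x s) * (t - s) := by
  have h1 : ∫ u in s..t, y u = x t - x s := by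
    rw [← hx.integral_deriv_eq_sub]
    refine intervalIntegral.integral_congr_ae ?_
    filter_upwards [hd] with u hu hut
    exact (hu (Set.uIoc_subset_uIcc hut)).deriv.symm
  rw [← h1]
  rcases hst.lt_or_gt with h | h
  · refine mul_pos (intervalIntegral.intervalIntegral_pos_of_pos_on hy.intervalIntegrable
      (fun u hu => hpos u ?_) h) (sub_pos.2 h)
    exact Set.Icc_subset_uIcc (Set.Ioo_subset_Icc_self hu)
  · rw [intervalIntegral.integral_symm]
    refine mul_pos_of_neg_of_neg (neg_neg_iff_pos.2 ?_) (sub_neg.2 h)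
    refine intervalIntegral.intervalIntegral_pos_of_pos_on hy.intervalIntegrable.symm
      (fun u hu => hpos u ?_) h
    exact Set.Icc_subset_uIcc' (Set.Ioo_subset_Icc_self hu)

section Uniqueness

variable {p : ℝ → ℝ} {I : Set ℝ} {φ₁ x₁ y₁ φ₂ x₂ y₂ : ℝ → ℝ}

/-- Solutions that agree at time `s` agree at time `t` if in between both positions have the same
strict sign, for then the two equations coincide. -/
lemma eq_of_same_sign (h₁ : IsSolutionOn p I φ₁ x₁ y₁) (h₂ : IsSolutionOn p I φ₂ x₂ y₂)
    (hφ : Set.EqOn φ₁ φ₂ I) {s t : ℝ} (hst : Set.uIcc s t ⊆ I)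
    (hsign : ∀ u ∈ Set.uIcc s t, u ≠ s → 0 < x₁ u * x₂ u) (hx : x₁ s = x₂ s) (hy : y₁ s = y₂ s) :
    x₁ t = x₂ t ∧ y₁ t = y₂ t := by
  have hs : s ∈ I := hst Set.left_mem_uIcc
  have hyy : ∀ u ∈ Set.uIcc s t, y₁ u = y₂ u := by
    intro u hu
    have hsu : Set.uIcc s u ⊆ Set.uIcc s t := Set.uIcc_subset_uIcc_left hu
    refine eq_of_ae_hasDerivAt_eq (h₁.ac_vel s hs u (hst hu)) (h₂.ac_vel s hs u (hst hu)) ?_ hy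
    have hne : ∀ᵐ v : ℝ, v ≠ s := by simp [ae_iff, measure_singleton]
    filter_upwards [h₁.eqn_vel, h₂.eqn_vel, hne] with v hv₁ hv₂ hvs hv
    have hvI := hst (hsu hv)
    obtain ⟨e₁, ⟨he₁, he₁', -⟩, hd₁⟩ := hv₁ hvI
    obtain ⟨e₂, ⟨he₂, he₂', -⟩, hd₂⟩ := hv₂ hvI
    have he : e₁ = e₂ := by
      rcases mul_pos_iff.1 (hsign v (hsu hv) hvs) with ⟨h, h'⟩ | ⟨h, h'⟩
      · rw [he₁ h, he₂ h']
      · rw [he₁' h, he₂' h']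
    rw [← hφ hvI, ← he] at hd₂
    exact ⟨_, hd₁, hd₂⟩
  have ht : t ∈ I := hst Set.right_mem_uIcc
  refine ⟨eq_of_ae_hasDerivAt_eq (h₁.ac_pos s hs t ht) (h₂.ac_pos s hs t ht) ?_ hx,
    hyy t Set.right_mem_uIcc⟩
  filter_upwards [h₁.eqn_pos, h₂.eqn_pos] with v hv₁ hv₂ hv
  exact ⟨_, hv₁ (hst hv), hyy v hv ▸ hv₂ (hst hv)⟩

/-- Local uniqueness at a point of a compact interval where a solution is not at rest on the
switching plane: either the position does not vanish, or it changes sign transversally. -/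
lemma eventually_eq_of_transversal {a b : ℝ} (hab : a ≤ b)
    (h₁ : IsSolutionOn p (Set.Icc a b) φ₁ x₁ y₁) (h₂ : IsSolutionOn p (Set.Icc a b) φ₂ x₂ y₂)
    (hφ : Set.EqOn φ₁ φ₂ (Set.Icc a b)) {s : ℝ} (hs : s ∈ Set.Icc a b)
    (htr : x₂ s ≠ 0 ∨ y₂ s ≠ 0) (hx : x₁ s = x₂ s) (hy : y₁ s = y₂ s) :
    ∀ᶠ t in nhdsWithin s (Set.Icc a b), x₁ t = x₂ t ∧ y₁ t = y₂ t := by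
  have ha : a ∈ Set.Icc a b := Set.left_mem_Icc.2 hab
  have hb : b ∈ Set.Icc a b := Set.right_mem_Icc.2 hab
  have cont : ∀ {f : ℝ → ℝ}, AbsolutelyContinuousOnInterval f a b → ContinuousOn f (Set.Icc a b) :=
    fun hf => Set.uIcc_of_le hab ▸ hf.continuousOn
  have cx₁ := cont (h₁.ac_pos a ha b hb)
  have cx₂ := cont (h₂.ac_pos a ha b hb)
  have cy₁ := cont (h₁.ac_vel a ha b hb)
  have cy₂ := cont (h₂.ac_vel a ha b hb)
  -- a property that holds near `s` holds on the whole segment between `s` and a nearby time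
  have segment : ∀ {P : ℝ → Prop}, (∀ᶠ t in nhdsWithin s (Set.Icc a b), P t) →
      ∀ᶠ t in nhdsWithin s (Set.Icc a b), Set.uIcc s t ⊆ Set.Icc a b ∧ ∀ u ∈ Set.uIcc s t, P u := by
    intro P hP
    rw [eventually_nhdsWithin_iff, Metric.eventually_nhds_iff] at hP ⊢
    obtain ⟨ε, hε, hP⟩ := hP
    refine ⟨ε, hε, fun t ht htI => ?_⟩
    have hsub : Set.uIcc s t ⊆ Set.Icc a b := Set.ordConnected_Icc.uIcc_subset hs htI
    refine ⟨hsub, fun u hu => hP ?_ (hsub hu)⟩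
    exact lt_of_le_of_lt (by
      simpa [Real.dist_eq] using Set.abs_sub_left_of_mem_uIcc hu) ht
  by_cases hx0 : x₂ s = 0
  · have hy0 : y₂ s ≠ 0 := htr.resolve_left (not_not.2 hx0)
    have hprod : ∀ t, Set.uIcc s t ⊆ Set.Icc a b →
        ((∀ u ∈ Set.uIcc s t, 0 < y₁ u ∧ 0 < y₂ u) ∨ ∀ u ∈ Set.uIcc s t, y₁ u < 0 ∧ y₂ u < 0) →
        s ≠ t → 0 < x₁ t * x₂ t := by
      intro t hst hsgn hne
      have ht := hst Set.right_mem_uIcc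
      have d₁ : ∀ᵐ u : ℝ, u ∈ Set.uIcc s t → HasDerivAt x₁ (y₁ u) u :=
        h₁.eqn_pos.mono fun u hu hut => hu (hst hut)
      have d₂ : ∀ᵐ u : ℝ, u ∈ Set.uIcc s t → HasDerivAt x₂ (y₂ u) u :=
        h₂.eqn_pos.mono fun u hu hut => hu (hst hut)
      have key : 0 < (x₁ t * (t - s)) * (x₂ t * (t - s)) := by
        rcases hsgn with h | h
        · have k₁ := sub_mul_sub_pos_of_hasDerivAt_pos (h₁.ac_pos s hs t ht) (cy₁.mono hst) d₁
            (fun u hu => (h u hu).1) hne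
          have k₂ := sub_mul_sub_pos_of_hasDerivAt_pos (h₂.ac_pos s hs t ht) (cy₂.mono hst) d₂
            (fun u hu => (h u hu).2) hne
          rw [hx, hx0, sub_zero] at k₁
          rw [hx0, sub_zero] at k₂
          exact mul_pos k₁ k₂
        · have k₁ := sub_mul_sub_pos_of_hasDerivAt_pos (h₁.ac_pos s hs t ht).neg (cy₁.mono hst).neg
            (d₁.mono fun u hu hut => (hu hut).neg) (fun u hu => neg_pos.2 (h u hu).1) hne
          have k₂ := sub_mul_sub_pos_of_hasDerivAt_pos (h₂.ac_pos s hs t ht).neg (cy₂.mono hst).neg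
            (d₂.mono fun u hu hut => (hu hut).neg) (fun u hu => neg_pos.2 (h u hu).2) hne
          simp only [Pi.neg_apply, hx, hx0] at k₁ k₂
          nlinarith [mul_pos k₁ k₂]
      have h2 : 0 < (t - s) * (t - s) := mul_self_pos.2 (sub_ne_zero.2 hne.symm)
      refine pos_of_mul_pos_left (b := (t - s) * (t - s)) ?_ h2.le
      linarith
    have hev : (∀ᶠ t in nhdsWithin s (Set.Icc a b), 0 < y₁ t ∧ 0 < y₂ t) ∨
        ∀ᶠ t in nhdsWithin s (Set.Icc a b), y₁ t < 0 ∧ y₂ t < 0 := by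
      rcases hy0.lt_or_gt with h | h
      · exact Or.inr (((cy₁ s hs).eventually_lt_const (hy ▸ h)).and
          ((cy₂ s hs).eventually_lt_const h))
      · exact Or.inl (((cy₁ s hs).eventually_const_lt (hy ▸ h)).and
          ((cy₂ s hs).eventually_const_lt h))
    rcases hev with h | h
    · filter_upwards [segment h] with t ht
      refine eq_of_same_sign h₁ h₂ hφ ht.1 (fun u hu hus => ?_) hx hy
      have hsub := Set.uIcc_subset_uIcc_left hu
      exact hprod u (hsub.trans ht.1) (Or.inl fun v hv => ht.2 v (hsub hv)) hus.symm
    · filter_upwards [segment h] with t ht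
      refine eq_of_same_sign h₁ h₂ hφ ht.1 (fun u hu hus => ?_) hx hy
      have hsub := Set.uIcc_subset_uIcc_left hu
      exact hprod u (hsub.trans ht.1) (Or.inr fun v hv => ht.2 v (hsub hv)) hus.symm
  · have hpos : 0 < x₁ s * x₂ s := by rw [hx]; exact mul_self_pos.2 hx0
    filter_upwards [segment (((cx₁ s hs).mul (cx₂ s hs)).eventually_const_lt hpos)] with t ht
    exact eq_of_same_sign h₁ h₂ hφ ht.1 (fun u hu _ => ht.2 u hu) hx hy

/-- Uniqueness: a solution that agrees once with a solution that is never at rest on the switching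
plane agrees with it at all times. -/
theorem eq_of_transversal (hI : I.OrdConnected) (h₁ : IsSolutionOn p I φ₁ x₁ y₁)
    (h₂ : IsSolutionOn p I φ₂ x₂ y₂) (hφ : Set.EqOn φ₁ φ₂ I)
    (htr : ∀ t ∈ I, x₂ t ≠ 0 ∨ y₂ t ≠ 0) {s t : ℝ} (hs : s ∈ I) (ht : t ∈ I)
    (hx : x₁ s = x₂ s) (hy : y₁ s = y₂ s) : x₁ t = x₂ t ∧ y₁ t = y₂ t := by
  set a := min s t
  set b := max s t
  have hab : a ≤ b := min_le_max
  have hJ : Set.Icc a b ⊆ I := hI.uIcc_subset hs ht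
  have g₁ := h₁.mono hJ
  have g₂ := h₂.mono hJ
  have cont : ∀ {f : ℝ → ℝ},
      (∀ u ∈ Set.Icc a b, ∀ v ∈ Set.Icc a b, AbsolutelyContinuousOnInterval f u v) →
      ContinuousOn f (Set.Icc a b) := fun hf => Set.uIcc_of_le hab ▸
    (hf a (Set.left_mem_Icc.2 hab) b (Set.right_mem_Icc.2 hab)).continuousOn
  -- the set of times of agreement is open and closed in the interval
  refine (isPreconnected_Icc.induction₂
    (fun u v => (x₁ u = x₂ u ∧ y₁ u = y₂ u) ↔ (x₁ v = x₂ v ∧ y₁ v = y₂ v)) ?_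
    (fun _ _ _ _ _ _ h h' => h.trans h') (fun _ _ _ _ h => h.symm)
    (show s ∈ Set.Icc a b from Set.left_mem_uIcc)
    (show t ∈ Set.Icc a b from Set.right_mem_uIcc)).1 ⟨hx, hy⟩
  intro u hu
  by_cases hag : x₁ u = x₂ u ∧ y₁ u = y₂ u
  · filter_upwards [eventually_eq_of_transversal hab g₁ g₂ (hφ.mono hJ) hu (htr u (hJ hu))
      hag.1 hag.2] with v hv
    exact iff_of_true hag hv
  · have hev : ∀ᶠ v in nhdsWithin u (Set.Icc a b), ¬(x₁ v = x₂ v ∧ y₁ v = y₂ v) := by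
      rcases not_and_or.1 hag with h | h
      · filter_upwards [((cont g₁.ac_pos).sub (cont g₂.ac_pos) u hu).eventually_ne
          (sub_ne_zero.2 h)] with v hv hv'
        exact hv (sub_eq_zero.2 hv'.1)
      · filter_upwards [((cont g₁.ac_vel).sub (cont g₂.ac_vel) u hu).eventually_ne
          (sub_ne_zero.2 h)] with v hv hv'
        exact hv (sub_eq_zero.2 hv'.2)
    filter_upwards [hev] with v hv
    exact iff_of_false hag hv

end Uniqueness

/-! ### The resonant solutions -/

/-- The free oscillation of amplitude `a²/2` is in resonance with the forcing, its half period `2a`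
being a multiple of `T`, and it is so fast that the forcing does not affect the signs. -/
structure IsResonant (T L a : ℝ) : Prop where
  exists_nat : ∃ m : ℕ, 2 * a = m * T
  lt : 2 * L < a

/-- The position at time `t` of the solution that has crossed the switching plane upwards at time
`t - σ`: forced response plus free oscillation. -/
noncomputable def position (q : ℝ → ℝ) (a t σ : ℝ) : ℝ := q t - q (t - σ) + wavePrim a σ

/-- The velocity at time `t` of the solution that has crossed the switching plane upwards at time
`t - σ`. -/
noncomputable def velocity (r : ℝ → ℝ) (a t σ : ℝ) : ℝ := r t + wave a σ

section Solutions

variable {T : ℝ} {p r q : ℝ → ℝ} {L a : ℝ}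

lemma IsResonant.pos (R : IsResonant T L a) (H : IsPeriodicPrimitive T p r q L) : 0 < a := by
  linarith [R.lt, H.bound_nonneg]

lemma IsResonant.periodic_half {β : Type*} (R : IsResonant T L a) {f : ℝ → β}
    (hf : Function.Periodic f T) : Function.Periodic f (2 * a) := by
  obtain ⟨m, hm⟩ := R.exists_nat
  rw [hm]
  exact hf.nat_mul m

lemma IsResonant.periodic {β : Type*} (R : IsResonant T L a) {f : ℝ → β}
    (hf : Function.Periodic f T) : Function.Periodic f (4 * a) := by
  have h := (R.periodic_half hf).nat_mul 2
  rwa [show ((2 : ℕ) : ℝ) * (2 * a) = 4 * a by push_cast; ring] at h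

lemma periodic_position (H : IsPeriodicPrimitive T p r q L) (R : IsResonant T L a) (t : ℝ) :
    Function.Periodic (position q a t) (4 * a) := fun σ => by
  rw [position, position, periodic_wavePrim (R.pos H) σ, ← sub_sub,
    (R.periodic H.periodic_pos).sub_eq]

/-- The free oscillation dominates the forced response: near each end of a half period the latter
is controlled by the Lipschitz constant of `q`. -/
lemma abs_sub_lt_of_isResonant (H : IsPeriodicPrimitive T p r q L) (R : IsResonant T L a)
    (t : ℝ) {σ : ℝ} (h0 : σ ≠ 0) (h : |σ| < 2 * a) :
    |q t - q (t - σ)| < |σ| * (2 * a - |σ|) / 2 := by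
  have hL := R.lt
  have hσ : 0 < |σ| := abs_pos.2 h0
  have hper := R.periodic_half H.periodic_pos
  rcases le_total |σ| a with h1 | h1
  · have h2 := H.abs_sub_le (t - σ) t
    rw [sub_sub_cancel] at h2
    nlinarith
  · have h2 : |q t - q (t - σ)| ≤ L * (2 * a - |σ|) := by
      rcases abs_cases σ with ⟨e, hs⟩ | ⟨e, hs⟩
      · have h3 := H.abs_sub_le (t - σ + 2 * a) t
        rwa [hper, show t - (t - σ + 2 * a) = -(2 * a - |σ|) by rw [e]; ring, abs_neg,
          abs_of_pos (by linarith : 0 < 2 * a - |σ|)] at h3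
      · have h3 := H.abs_sub_le (t - σ - 2 * a) t
        rwa [hper.sub_eq, show t - (t - σ - 2 * a) = 2 * a - |σ| by rw [e]; ring,
          abs_of_pos (by linarith : 0 < 2 * a - |σ|)] at h3
    nlinarith

lemma position_pos (H : IsPeriodicPrimitive T p r q L) (R : IsResonant T L a) (t : ℝ) {σ : ℝ}
    (h0 : 0 < σ) (h : σ < 2 * a) : 0 < position q a t σ := by
  have h1 : |σ| < 2 * a := by rwa [abs_of_pos h0]
  have h2 := (abs_lt.1 (abs_sub_lt_of_isResonant H R t h0.ne' h1)).1
  rw [position, wavePrim_of_abs_le (R.pos H) h1.le]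
  rw [abs_of_pos h0] at *
  linarith

lemma position_neg (H : IsPeriodicPrimitive T p r q L) (R : IsResonant T L a) (t : ℝ) {σ : ℝ}
    (h0 : σ < 0) (h : -(2 * a) < σ) : position q a t σ < 0 := by
  have h1 : |σ| < 2 * a := by rw [abs_of_neg h0]; linarith
  have h2 := (abs_lt.1 (abs_sub_lt_of_isResonant H R t h0.ne h1)).2
  rw [position, wavePrim_of_abs_le (R.pos H) h1.le]
  rw [abs_of_neg h0] at *
  linarith

lemma position_zero (t : ℝ) : position q a t 0 = 0 := by
  simp [position, wavePrim]

lemma position_two_mul (H : IsPeriodicPrimitive T p r q L) (R : IsResonant T L a) (t : ℝ) :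
    position q a t (2 * a) = 0 := by
  have h := R.pos H
  have h1 : |2 * a| = 2 * a := abs_of_pos (by positivity)
  rw [position, (R.periodic_half H.periodic_pos).sub_eq, wavePrim_of_abs_le h h1.le, h1]
  ring

/-- The signs of the position agree with those of the free oscillation, and the switching plane is
crossed with nonzero velocity, at multiples of the half period. -/
lemma position_trichotomy (H : IsPeriodicPrimitive T p r q L) (R : IsResonant T L a) (t σ : ℝ) :
    (0 < position q a t σ ∧ HasDerivAt (wave a) (-1) σ) ∨
      (position q a t σ < 0 ∧ HasDerivAt (wave a) 1 σ) ∨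
      (velocity r a t σ ≠ 0 ∧ ∃ k : ℤ, σ = k * (2 * a)) := by
  have ha := R.pos H
  obtain ⟨σ₀, ⟨h1, h2⟩, k, rfl⟩ := exists_eq_add_period ha σ
  have hderiv : ∀ {d}, HasDerivAt (wave a) d σ₀ → HasDerivAt (wave a) d (σ₀ + k * (4 * a)) := by
    intro d hd
    have h3 : wave a = fun s => wave a (s - k * (4 * a)) :=
      funext fun s => ((periodic_wave a).sub_int_mul_eq k).symm
    rw [h3]
    refine HasDerivAt.comp_sub_const _ _ ?_
    rwa [add_sub_cancel_right]
  rw [(periodic_position H R t).int_mul k σ₀, velocity, (periodic_wave a).int_mul k σ₀]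
  have hr := abs_le.1 (H.bound t)
  have hL := R.lt
  have hL0 := H.bound_nonneg
  rcases lt_trichotomy σ₀ 0 with h | rfl | h
  · exact Or.inr (Or.inl ⟨position_neg H R t h h1, hderiv (hasDerivAt_wave_of_neg h h1)⟩)
  · refine Or.inr (Or.inr ⟨?_, 2 * k, by push_cast; ring⟩)
    rw [wave_of_abs_le ha (by rw [abs_zero]; positivity), abs_zero]
    exact ne_of_gt (by linarith [hr.1])
  · rcases h2.eq_or_lt with rfl | h2
    · refine Or.inr (Or.inr ⟨?_, 2 * k + 1, by push_cast; ring⟩)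
      rw [wave_of_abs_le ha (by rw [abs_of_pos h]), abs_of_pos h]
      exact ne_of_lt (by linarith [hr.2])
    · exact Or.inl ⟨position_pos H R t h h2, hderiv (hasDerivAt_wave_of_pos h h2)⟩

lemma ae_add_ne_int_mul (c d : ℝ) : ∀ᵐ t : ℝ, ∀ k : ℤ, t + c ≠ k * d := by
  rw [ae_all_iff]
  intro k
  have h : ∀ᵐ t : ℝ, t ≠ k * d - c := by simp [ae_iff, measure_singleton]
  filter_upwards [h] with t ht hk
  exact ht (by linarith)

lemma ae_position_ne_zero (H : IsPeriodicPrimitive T p r q L) (R : IsResonant T L a) (b c : ℝ) :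
    ∀ᵐ t : ℝ, position q a (t + b) (t + c) ≠ 0 := by
  filter_upwards [ae_add_ne_int_mul c (2 * a)] with t ht
  rcases position_trichotomy H R (t + b) (t + c) with h | h | ⟨-, k, hk⟩
  · exact h.1.ne'
  · exact h.1.ne
  · exact absurd hk (ht k)

lemma position_ne_zero_or_velocity_ne_zero (H : IsPeriodicPrimitive T p r q L)
    (R : IsResonant T L a) (t σ : ℝ) : position q a t σ ≠ 0 ∨ velocity r a t σ ≠ 0 := by
  rcases position_trichotomy H R t σ with h | h | h
  · exact Or.inl h.1.ne'
  · exact Or.inl h.1.ne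
  · exact Or.inr h.1

lemma isSolutionOn_position (H : IsPeriodicPrimitive T p r q L) (R : IsResonant T L a) (b c : ℝ) :
    IsSolutionOn p Set.univ (fun t => t + b) (fun t => position q a (t + b) (t + c))
      (fun t => velocity r a (t + b) (t + c)) := by
  have hpos : ∀ t, HasDerivAt (fun t => position q a (t + b) (t + c))
      (velocity r a (t + b) (t + c)) t := by
    intro t
    -- the difference `t + b - (t + c)` of phase and time since crossing is constant
    have h1 : (fun t => position q a (t + b) (t + c)) =
        fun t => q (t + b) - q (b - c) + wavePrim a (t + c) := by
      funext t
      rw [position, add_sub_add_left_eq_sub]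
    rw [h1]
    exact (((H.hasDerivAt_pos _).comp_add_const t b).sub_const _).add
      ((hasDerivAt_wavePrim a _).comp_add_const t c)
  have hv : Continuous fun t => velocity r a (t + b) (t + c) :=
    (H.continuous_vel.comp (continuous_add_const b)).add
      ((continuous_wave a).comp (continuous_add_const c))
  refine ⟨fun s _ t _ => ?_, fun s _ t _ => ?_, fun s _ t _ => ?_, ?_, ?_, ?_⟩
  · exact
      (LipschitzWith.id.add (LipschitzWith.const b)).lipschitzOnWith.absolutelyContinuousOnInterval
  · have h2 : (fun t => position q a (t + b) (t + c)) = fun t => position q a (s + b) (s + c) +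
        ∫ u in s..t, velocity r a (u + b) (u + c) := by
      funext t
      rw [intervalIntegral.integral_eq_sub_of_hasDerivAt (fun u _ => hpos u)
        (hv.intervalIntegrable _ _)]
      ring
    rw [h2]
    exact AbsolutelyContinuousOnInterval.fun_add
      (LipschitzWith.const _).lipschitzOnWith.absolutelyContinuousOnInterval
      ((hv.intervalIntegrable s t).absolutelyContinuousOnInterval_intervalIntegral (by simp))
  · exact (H.ac_vel_add b s t).fun_add (((lipschitzWith_wave a).comp
      (LipschitzWith.id.add (LipschitzWith.const c))).lipschitzOnWith.absolutelyContinuousOnInterval)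
  · exact Filter.Eventually.of_forall fun t _ => (hasDerivAt_id t).add_const b
  · exact Filter.Eventually.of_forall fun t _ => hpos t
  · filter_upwards [H.ae_hasDerivAt_vel_add b, ae_add_ne_int_mul c (2 * a)] with t h1 h2 _
    rcases position_trichotomy H R (t + b) (t + c) with ⟨h, hd⟩ | ⟨h, hd⟩ | ⟨-, k, hk⟩
    · refine ⟨1, ⟨fun _ => rfl, fun h' => absurd h' h.not_gt, by norm_num⟩, ?_⟩
      rw [add_comm (-1 : ℝ)]
      exact h1.add (hd.comp_add_const t c)
    · refine ⟨-1, ⟨fun h' => absurd h' h.not_gt, fun _ => rfl, by norm_num⟩, ?_⟩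
      rw [neg_neg, add_comm (1 : ℝ)]
      exact h1.add (hd.comp_add_const t c)
    · exact absurd hk (h2 k)

end Solutions

/-! ### The region between two graphs over the velocity -/

/-- The larger position on the torus of parameter `a` at phase `θ`, where `v` is the velocity
relative to the forced response, `|v| ≤ a`, and `Q` the position of the forced response. -/
noncomputable def upper {T : ℝ} (Q : AddCircle T → ℝ) (a : ℝ) (θ : AddCircle T) (v : ℝ) : ℝ :=
  Q θ - Q (θ - ((a - v : ℝ) : AddCircle T)) + (a ^ 2 - v ^ 2) / 2

/-- The smaller position on the torus of parameter `a` at phase `θ`, where `v` is the velocity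
relative to the forced response, `|v| ≤ a`, and `Q` the position of the forced response. -/
noncomputable def lower {T : ℝ} (Q : AddCircle T → ℝ) (a : ℝ) (θ : AddCircle T) (v : ℝ) : ℝ :=
  Q θ - Q (θ - ((v - a : ℝ) : AddCircle T)) - (a ^ 2 - v ^ 2) / 2

/-- The open solid torus of parameter `a`; `Rv` and `Q` are velocity and position of the forced
response. -/
def openRegion {T : ℝ} (Rv Q : AddCircle T → ℝ) (a : ℝ) : Set (Phase T) :=
  {z | |z.2.2 - Rv z.1| < a ∧ lower Q a z.1 (z.2.2 - Rv z.1) < z.2.1 ∧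
    z.2.1 < upper Q a z.1 (z.2.2 - Rv z.1)}

/-- The closed solid torus of parameter `a`. -/
def closedRegion {T : ℝ} (Rv Q : AddCircle T → ℝ) (a : ℝ) : Set (Phase T) :=
  {z | |z.2.2 - Rv z.1| ≤ a ∧ lower Q a z.1 (z.2.2 - Rv z.1) ≤ z.2.1 ∧
    z.2.1 ≤ upper Q a z.1 (z.2.2 - Rv z.1)}

/-- The torus of parameter `a`, as the boundary of the solid torus. -/
def torus {T : ℝ} (Rv Q : AddCircle T → ℝ) (a : ℝ) : Set (Phase T) :=
  closedRegion Rv Q a \ openRegion Rv Q a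

section Regions

variable {T : ℝ} {Rv Q : AddCircle T → ℝ} {a : ℝ}

lemma continuous_upper (hR : Continuous Rv) (hQ : Continuous Q) :
    Continuous fun z : Phase T => upper Q a z.1 (z.2.2 - Rv z.1) := by
  have hc : Continuous fun s : ℝ => (s : AddCircle T) := AddCircle.continuous_mk' T
  have h1 : Continuous fun z : Phase T => ((a - (z.2.2 - Rv z.1) : ℝ) : AddCircle T) :=
    hc.comp (by fun_prop)
  unfold upper
  fun_prop

lemma continuous_lower (hR : Continuous Rv) (hQ : Continuous Q) :
    Continuous fun z : Phase T => lower Q a z.1 (z.2.2 - Rv z.1) := by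
  have hc : Continuous fun s : ℝ => (s : AddCircle T) := AddCircle.continuous_mk' T
  have h1 : Continuous fun z : Phase T => ((z.2.2 - Rv z.1 - a : ℝ) : AddCircle T) :=
    hc.comp (by fun_prop)
  unfold lower
  fun_prop

lemma isOpen_openRegion (hR : Continuous Rv) (hQ : Continuous Q) :
    IsOpen (openRegion Rv Q a) :=
  (isOpen_lt (f := fun z : Phase T => |z.2.2 - Rv z.1|) (by fun_prop) continuous_const).inter
    ((isOpen_lt (continuous_lower hR hQ) continuous_snd.fst).inter
      (isOpen_lt continuous_snd.fst (continuous_upper hR hQ)))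

lemma isClosed_closedRegion (hR : Continuous Rv) (hQ : Continuous Q) :
    IsClosed (closedRegion Rv Q a) :=
  (isClosed_le (f := fun z : Phase T => |z.2.2 - Rv z.1|) (by fun_prop) continuous_const).inter
    ((isClosed_le (continuous_lower hR hQ) continuous_snd.fst).inter
      (isClosed_le continuous_snd.fst (continuous_upper hR hQ)))

lemma openRegion_subset_closedRegion : openRegion Rv Q a ⊆ closedRegion Rv Q a :=
  fun _ h => ⟨h.1.le, h.2.1.le, h.2.2.le⟩

lemma exists_abs_le_of_continuous (hT : 0 < T) (hQ : Continuous Q) : ∃ M, ∀ θ, |Q θ| ≤ M := by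
  have := Fact.mk hT
  obtain ⟨M, hM⟩ := isCompact_univ.exists_bound_of_continuousOn hQ.continuousOn
  exact ⟨M, fun θ => hM θ (Set.mem_univ θ)⟩

lemma isBounded_openRegion (hT : 0 < T) (hR : Continuous Rv) (hQ : Continuous Q) :
    Bornology.IsBounded (openRegion Rv Q a) := by
  have := Fact.mk hT
  obtain ⟨M, hM⟩ := exists_abs_le_of_continuous hT hQ
  obtain ⟨L, hL⟩ := exists_abs_le_of_continuous hT hR
  refine IsCompact.isBounded (s := Set.univ ×ˢ
    (Set.Icc (-(2 * M + a ^ 2 / 2)) (2 * M + a ^ 2 / 2) ×ˢ Set.Icc (-(L + a)) (L + a)))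
    (isCompact_univ.prod (isCompact_Icc.prod isCompact_Icc))
    |>.subset ?_
  rintro ⟨θ, x, y⟩ ⟨h1, h2, h3⟩
  simp only [upper, lower] at h1 h2 h3
  have k1 := abs_le.1 (hM θ)
  have k2 := abs_le.1 (hM (θ - ((a - (y - Rv θ) : ℝ) : AddCircle T)))
  have k3 := abs_le.1 (hM (θ - ((y - Rv θ - a : ℝ) : AddCircle T)))
  have k4 := abs_le.1 (hL θ)
  have k5 := abs_lt.1 h1
  have k6 := sq_nonneg (y - Rv θ)
  refine ⟨Set.mem_univ _, ⟨?_, ?_⟩, ?_, ?_⟩ <;> dsimp only <;> linarith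

/-- Outside the closed region one can escape to infinity along a horizontal ray. -/
lemma exists_ray_of_notMem {z : Phase T} (hz : z ∉ closedRegion Rv Q a) :
    ∃ e : ℝ, |e| = 1 ∧ ∀ s : ℝ, 0 ≤ s → (z.1, z.2.1 + e * s, z.2.2) ∉ closedRegion Rv Q a := by
  by_cases h : upper Q a z.1 (z.2.2 - Rv z.1) < z.2.1
  · refine ⟨1, abs_one, fun s hs hmem => ?_⟩
    have := hmem.2.2
    dsimp only at this
    linarith
  · refine ⟨-1, by simp, fun s hs hmem => hz ⟨hmem.1, ?_, not_lt.1 h⟩⟩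
    have := hmem.2.1
    dsimp only at this
    linarith

/-- The region enclosed by the torus is the open solid torus: the open solid torus and the
complement of the closed one are open and disjoint, the former is bounded, and no component of the
latter is. -/
lemma enclosed_torus (hT : 0 < T) (hR : Continuous Rv) (hQ : Continuous Q) :
    enclosed T (torus Rv Q a) = openRegion Rv Q a := by
  have hcompl : (torus Rv Q a)ᶜ ⊆ openRegion Rv Q a ∪ (closedRegion Rv Q a)ᶜ := by
    intro z hz
    by_contra hc
    rw [Set.mem_union, not_or, Set.notMem_compl_iff] at hc
    exact hz ⟨hc.2, hc.1⟩
  ext z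
  constructor
  · rintro ⟨hz, hb⟩
    refine (hcompl hz).resolve_right fun hzC => ?_
    obtain ⟨e, he, hray⟩ := exists_ray_of_notMem hzC
    have hcont : Continuous fun s : ℝ => ((z.1, z.2.1 + e * s, z.2.2) : Phase T) := by fun_prop
    have hsub : (fun s : ℝ => ((z.1, z.2.1 + e * s, z.2.2) : Phase T)) '' Set.Ici 0 ⊆
        connectedComponentIn (torus Rv Q a)ᶜ z := by
      refine (isPreconnected_Ici.image _ hcont.continuousOn).subset_connectedComponentIn
        ⟨0, Set.self_mem_Ici, by simp⟩ ?_
      rintro _ ⟨s, hs, rfl⟩ hmem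
      exact hray s hs hmem.1
    obtain ⟨C, hC⟩ := Metric.isBounded_iff.1 (hb.subset hsub)
    have hd := hC ⟨0, Set.self_mem_Ici, rfl⟩ ⟨|C| + 1, Set.mem_Ici.2 (by positivity), rfl⟩
    have hd' : dist (z.2.1 + e * 0) (z.2.1 + e * (|C| + 1)) ≤ C :=
      (((le_max_left _ _).trans (le_max_right _ _)).trans (le_of_eq (by rfl))).trans hd
    rw [dist_add_left, Real.dist_eq, mul_zero, zero_sub, abs_neg, abs_mul, he, one_mul,
      abs_of_pos (by positivity)] at hd'
    linarith [le_abs_self C]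
  · intro hz
    refine ⟨fun h => h.2 hz, (isBounded_openRegion (a := a) hT hR hQ).subset ?_⟩
    refine isPreconnected_connectedComponentIn.subset_left_of_subset_union
      (isOpen_openRegion hR hQ) (isClosed_closedRegion hR hQ).isOpen_compl ?_
      ((connectedComponentIn_subset _ _).trans hcompl)
      ⟨z, mem_connectedComponentIn (fun h => h.2 hz), hz⟩
    exact Set.disjoint_compl_right_iff_subset.2 openRegion_subset_closedRegion

end Regions

/-! ### The torus of resonant solutions -/

lemma continuous_periodic_lift {β : Type*} [TopologicalSpace β] {f : ℝ → β} {c : ℝ}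
    (hf : Function.Periodic f c) (hc : Continuous f) :
    Continuous (hf.lift : AddCircle c → β) :=
  continuous_quot_lift _ hc

section Torus

variable {T : ℝ} {p r q : ℝ → ℝ} {L a : ℝ}

/-- The velocity of the forced response as a function on the circle. -/
noncomputable def IsPeriodicPrimitive.velLift (H : IsPeriodicPrimitive T p r q L) :
    AddCircle T → ℝ :=
  H.periodic_vel.lift

/-- The position of the forced response as a function on the circle. -/
noncomputable def IsPeriodicPrimitive.posLift (H : IsPeriodicPrimitive T p r q L) :
    AddCircle T → ℝ :=
  H.periodic_pos.lift

/-- The projection of the circle of the free oscillation to the circle of phases. -/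
noncomputable def IsResonant.proj (R : IsResonant T L a) : AddCircle (4 * a) → AddCircle T :=
  (R.periodic (f := fun σ : ℝ => (σ : AddCircle T)) fun σ => AddCircle.coe_add_period T σ).lift

/-- The parametrization of the torus by the phase and the time since the last upward crossing of
the switching plane. -/
noncomputable def torusMap (H : IsPeriodicPrimitive T p r q L) (R : IsResonant T L a)
    (u : AddCircle T × AddCircle (4 * a)) : Phase T :=
  (u.1, H.posLift u.1 - H.posLift (u.1 - R.proj u.2) + (periodic_wavePrim (R.pos H)).lift u.2,
    H.velLift u.1 + (periodic_wave a).lift u.2)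

lemma torusMap_coe (H : IsPeriodicPrimitive T p r q L) (R : IsResonant T L a) (t σ : ℝ) :
    torusMap H R ((t : AddCircle T), (σ : AddCircle (4 * a))) =
      ((t : AddCircle T), position q a t σ, velocity r a t σ) := rfl

lemma IsPeriodicPrimitive.continuous_velLift (H : IsPeriodicPrimitive T p r q L) :
    Continuous H.velLift := continuous_periodic_lift _ H.continuous_vel

lemma IsPeriodicPrimitive.continuous_posLift (H : IsPeriodicPrimitive T p r q L) :
    Continuous H.posLift := continuous_periodic_lift _ H.continuous_pos

lemma IsResonant.continuous_proj (R : IsResonant T L a) : Continuous R.proj :=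
  continuous_periodic_lift _ (AddCircle.continuous_mk' T)

lemma continuous_torusMap (H : IsPeriodicPrimitive T p r q L) (R : IsResonant T L a) :
    Continuous (torusMap H R) := by
  have h1 := H.continuous_velLift
  have h2 := H.continuous_posLift
  have h3 := R.continuous_proj
  have h4 := continuous_periodic_lift (periodic_wave a) (continuous_wave a)
  have h5 := continuous_periodic_lift (periodic_wavePrim (R.pos H))
    (continuous_iff_continuousAt.2 fun t => (hasDerivAt_wavePrim a t).continuousAt)
  unfold torusMap
  fun_prop

lemma exists_coe_eq (ha : 0 < a) (s : AddCircle (4 * a)) :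
    ∃ σ ∈ Set.Ioc (-(2 * a)) (2 * a), (σ : AddCircle (4 * a)) = s := by
  obtain ⟨σ, rfl⟩ := QuotientAddGroup.mk_surjective s
  obtain ⟨σ₀, h, k, rfl⟩ := exists_eq_add_period ha σ
  refine ⟨σ₀, h, ?_⟩
  rw [AddCircle.coe_add, ← zsmul_eq_mul, AddCircle.coe_zsmul, AddCircle.coe_period, smul_zero,
    add_zero]

/-- Phase, velocity and the sign of the position determine the time since the last upward
crossing. -/
lemma injective_torusMap (H : IsPeriodicPrimitive T p r q L) (R : IsResonant T L a) :
    Function.Injective (torusMap H R) := by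
  have ha := R.pos H
  have aux : ∀ {t σ σ' : ℝ}, σ ∈ Set.Ioc (-(2 * a)) (2 * a) → σ' ∈ Set.Ioc (-(2 * a)) (2 * a) →
      position q a t σ = position q a t σ' → |σ| = |σ'| → σ < 0 → 0 < σ' → False := by
    intro t σ σ' h h' hx habs h0 h0'
    rw [abs_of_neg h0, abs_of_pos h0'] at habs
    have h1 := position_neg H R t h0 h.1
    have h2 := position_pos H R t h0' (by linarith [h.1])
    linarith
  rintro ⟨θ, s⟩ ⟨θ', s'⟩ h
  obtain ⟨t, rfl⟩ := QuotientAddGroup.mk_surjective θ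
  obtain ⟨σ, hσ, rfl⟩ := exists_coe_eq ha s
  obtain ⟨σ', hσ', rfl⟩ := exists_coe_eq ha s'
  obtain rfl : ((t : ℝ) : AddCircle T) = θ' := congrArg Prod.fst h
  have hx : position q a t σ = position q a t σ' := congrArg (fun z => z.2.1) h
  have hy : velocity r a t σ = velocity r a t σ' := congrArg (fun z => z.2.2) h
  rw [velocity, velocity, wave_of_abs_le ha (abs_le.2 ⟨hσ.1.le, hσ.2⟩),
    wave_of_abs_le ha (abs_le.2 ⟨hσ'.1.le, hσ'.2⟩)] at hy
  have habs : |σ| = |σ'| := by linarith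
  suffices σ = σ' by rw [this]
  rcases abs_eq_abs.1 habs with h1 | h1
  · exact h1
  rcases lt_trichotomy σ 0 with h0 | h0 | h0
  · exact (aux hσ hσ' hx habs h0 (by linarith)).elim
  · rw [h0] at h1 ⊢; linarith
  · exact (aux hσ' hσ hx.symm habs.symm (by linarith) h0).elim

lemma upper_coe (H : IsPeriodicPrimitive T p r q L) (R : IsResonant T L a) (t : ℝ) {v : ℝ}
    (h : |v| ≤ a) : upper H.posLift a (t : AddCircle T) v = position q a t (a - v) := by
  have h1 := abs_le.1 h
  have h2 : |a - v| = a - v := abs_of_nonneg (by linarith)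
  rw [position, wavePrim_of_abs_le (R.pos H) (by rw [h2]; linarith), h2]
  change q t - q (t - (a - v)) + _ = _
  ring

lemma lower_coe (H : IsPeriodicPrimitive T p r q L) (R : IsResonant T L a) (t : ℝ) {v : ℝ}
    (h : |v| ≤ a) : lower H.posLift a (t : AddCircle T) v = position q a t (v - a) := by
  have h1 := abs_le.1 h
  have h2 : |v - a| = a - v := by rw [abs_of_nonpos (by linarith)]; ring
  rw [position, wavePrim_of_abs_le (R.pos H) (by rw [h2]; linarith), h2]
  change q t - q (t - (v - a)) - _ = _
  ring

lemma position_neg_two_mul (H : IsPeriodicPrimitive T p r q L) (R : IsResonant T L a) (t : ℝ) :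
    position q a t (-(2 * a)) = 0 := by
  rw [← periodic_position H R, ← position_two_mul H R t]
  congr 1; ring

lemma position_nonneg (H : IsPeriodicPrimitive T p r q L) (R : IsResonant T L a) (t : ℝ) {σ : ℝ}
    (h0 : 0 ≤ σ) (h : σ ≤ 2 * a) : 0 ≤ position q a t σ := by
  rcases h0.eq_or_lt with rfl | h0
  · exact (position_zero t).ge
  · rcases h.eq_or_lt with rfl | h
    · exact (position_two_mul H R t).ge
    · exact (position_pos H R t h0 h).le

lemma position_nonpos (H : IsPeriodicPrimitive T p r q L) (R : IsResonant T L a) (t : ℝ) {σ : ℝ}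
    (h0 : σ ≤ 0) (h : -(2 * a) ≤ σ) : position q a t σ ≤ 0 := by
  rcases h0.eq_or_lt with rfl | h0
  · exact (position_zero t).le
  · rcases h.eq_or_lt with rfl | h
    · exact (position_neg_two_mul H R t).le
    · exact (position_neg H R t h0 h).le

lemma range_torusMap (H : IsPeriodicPrimitive T p r q L) (R : IsResonant T L a) :
    Set.range (torusMap H R) = torus H.velLift H.posLift a := by
  have ha := R.pos H
  ext ⟨θ, x, y⟩
  obtain ⟨t, rfl⟩ := QuotientAddGroup.mk_surjective θ
  have hvel : H.velLift (t : AddCircle T) = r t := rfl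
  constructor
  · rintro ⟨⟨θ, s⟩, h⟩
    obtain ⟨σ, hσ, rfl⟩ := exists_coe_eq ha s
    obtain rfl : θ = (t : AddCircle T) := congrArg Prod.fst h
    rw [torusMap_coe, Prod.mk.injEq, Prod.mk.injEq] at h
    obtain ⟨-, rfl, rfl⟩ := h
    have hσa : |σ| ≤ 2 * a := abs_le.2 ⟨hσ.1.le, hσ.2⟩
    have hv : velocity r a t σ - H.velLift (t : AddCircle T) = a - |σ| := by
      rw [hvel, velocity, wave_of_abs_le ha hσa]; ring
    have hva : |(a - |σ|)| ≤ a := abs_le.2 ⟨by linarith, by linarith [abs_nonneg σ]⟩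
    have hu := upper_coe H R t hva
    have hl := lower_coe H R t hva
    rw [show a - (a - |σ|) = |σ| by ring] at hu
    rw [show a - |σ| - a = -|σ| by ring] at hl
    have hu0 := position_nonneg H R t (abs_nonneg σ) hσa
    have hl0 := position_nonpos H R t (neg_nonpos.2 (abs_nonneg σ)) (neg_le_neg hσa)
    rcases le_total 0 σ with h0 | h0
    · rw [abs_of_nonneg h0] at *
      refine ⟨⟨hv ▸ hva, ?_, ?_⟩, fun hmem => ?_⟩
      · dsimp only; rw [hv, hl]; linarith
      · dsimp only; rw [hv, hu]
      · have := hmem.2.2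
        dsimp only at this
        rw [hv, hu] at this
        exact lt_irrefl _ this
    · rw [abs_of_nonpos h0] at *
      rw [neg_neg] at hl hl0
      refine ⟨⟨hv ▸ hva, ?_, ?_⟩, fun hmem => ?_⟩
      · dsimp only; rw [hv, hl]
      · dsimp only; rw [hv, hu]; linarith
      · have := hmem.2.1
        dsimp only at this
        rw [hv, hl] at this
        exact lt_irrefl _ this
  · rintro ⟨⟨h1, h2, h3⟩, h4⟩
    simp only [hvel] at h1 h2 h3
    have hu := upper_coe H R t h1
    have hl := lower_coe H R t h1
    have hv := abs_le.1 h1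
    have hx : x = position q a t (a - (y - r t)) ∨ x = position q a t (y - r t - a) := by
      by_contra hc
      rw [not_or] at hc
      refine h4 ⟨lt_of_le_of_ne h1 fun he => hc.1 ?_, lt_of_le_of_ne h2 fun he => hc.2 ?_,
        lt_of_le_of_ne h3 fun he => hc.1 ?_⟩
      · -- at the extreme velocities both graphs meet the switching plane
        dsimp only at he
        rw [hvel] at he
        rw [hu] at h3
        rw [hl] at h2
        rcases (abs_eq ha.le).1 he with e | e
        · rw [e, sub_self, position_zero] at h2 h3 ⊢
          linarith
        · rw [e, show a - -a = 2 * a by ring, position_two_mul H R] at h3 ⊢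
          rw [e, show -a - a = -(2 * a) by ring, position_neg_two_mul H R] at h2
          linarith
      · rw [← hl]; exact he.symm
      · rw [← hu]; exact he
    rcases hx with hx | hx
    · refine ⟨((t : AddCircle T), ((a - (y - r t) : ℝ) : AddCircle (4 * a))), ?_⟩
      have h5 : |a - (y - r t)| = a - (y - r t) := abs_of_nonneg (by linarith)
      rw [torusMap_coe, ← hx, velocity, wave_of_abs_le ha (by rw [h5]; linarith), h5]
      congr 2; ring
    · refine ⟨((t : AddCircle T), ((y - r t - a : ℝ) : AddCircle (4 * a))), ?_⟩
      have h5 : |y - r t - a| = a - (y - r t) := by rw [abs_of_nonpos (by linarith)]; ring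
      rw [torusMap_coe, ← hx, velocity, wave_of_abs_le ha (by rw [h5]; linarith), h5]
      congr 2; ring

end Torus

/-! ### Invariance, foliation and nesting -/

section Properties

variable {T : ℝ} {p r q : ℝ → ℝ} {L a : ℝ}

/-- The torus as a product of circles: a continuous injection of a compact space into a Hausdorff
space is a homeomorphism onto its range. -/
lemma exists_homeomorph_torus (H : IsPeriodicPrimitive T p r q L) (R : IsResonant T L a) :
    ∃ h : (AddCircle T × AddCircle (4 * a)) ≃ₜ torus H.velLift H.posLift a,
      ∀ u, (h u : Phase T) = torusMap H R u := by
  have := Fact.mk H.pos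
  have := Fact.mk (show 0 < 4 * a by linarith [R.pos H])
  have hemb := ((continuous_torusMap H R).isClosedEmbedding (injective_torusMap H R)).isEmbedding
  exact ⟨hemb.toHomeomorph.trans (Homeomorph.setCongr (range_torusMap H R)), fun u => rfl⟩

lemma isTorus_torus (H : IsPeriodicPrimitive T p r q L) (R : IsResonant T L a) :
    IsTorus T (torus H.velLift H.posLift a) := by
  obtain ⟨h, hh⟩ := exists_homeomorph_torus H R
  have ha : 4 * a ≠ 0 := by linarith [R.pos H]
  refine ⟨((Homeomorph.refl _).prodCongr (AddCircle.homeomorphCircle ha).symm).trans h,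
    fun θ c => ?_⟩
  exact congrArg Prod.fst (hh (θ, (AddCircle.homeomorphCircle ha).symm c))

/-- A solution that meets the torus agrees once with one of the resonant solutions. These are never
at rest on the switching plane, so by uniqueness it agrees with it at all times. -/
lemma isInvariant_torus (H : IsPeriodicPrimitive T p r q L) (R : IsResonant T L a) :
    IsInvariant T p (torus H.velLift H.posLift a) := by
  intro I φ x y hI hsol t₀ ht₀ hmem t ht
  rw [← range_torusMap H R] at hmem ⊢
  obtain ⟨⟨θ, s⟩, h⟩ := hmem
  obtain ⟨σ, -, rfl⟩ := exists_coe_eq (R.pos H) s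
  obtain rfl : θ = ((φ t₀ : ℝ) : AddCircle T) := congrArg Prod.fst h
  rw [torusMap_coe, curve, Prod.mk.injEq, Prod.mk.injEq] at h
  obtain ⟨-, hx, hy⟩ := h
  have hφ : Set.EqOn φ (fun u => u + (φ t₀ - t₀)) I := fun u hu => hsol.phase_eq hI ht₀ hu
  have hb : t₀ + (φ t₀ - t₀) = φ t₀ := by ring
  have hc : t₀ + (σ - t₀) = σ := by ring
  have key := eq_of_transversal hI hsol
    ((isSolutionOn_position H R (φ t₀ - t₀) (σ - t₀)).mono (Set.subset_univ I)) hφ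
    (fun u _ => position_ne_zero_or_velocity_ne_zero H R _ _) ht₀ ht
    (by rw [hb, hc, hx]) (by rw [hb, hc, hy])
  refine ⟨(((t + (φ t₀ - t₀) : ℝ) : AddCircle T), ((t + (σ - t₀) : ℝ) : AddCircle (4 * a))), ?_⟩
  rw [torusMap_coe, curve, hφ ht, key.1, key.2]

/-- The phase at the last upward crossing is constant along each resonant solution; it parametrizes
the leaves of the foliation. -/
lemma isFoliatedByPeriodicSolutions_torus (H : IsPeriodicPrimitive T p r q L)
    (R : IsResonant T L a) :
    IsFoliatedByPeriodicSolutions T p (torus H.velLift H.posLift a) := by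
  obtain ⟨h, hh⟩ := exists_homeomorph_torus H R
  have ha : 4 * a ≠ 0 := by linarith [R.pos H]
  have hproj := R.continuous_proj
  -- the shear that turns the phase of the last crossing into the present phase
  let shear : (AddCircle T × AddCircle (4 * a)) ≃ₜ (AddCircle T × AddCircle (4 * a)) :=
    { toFun := fun u => (R.proj u.2 + u.1, u.2)
      invFun := fun u => (u.1 - R.proj u.2, u.2)
      left_inv := fun u => by simp
      right_inv := fun u => by simp
      continuous_toFun := by fun_prop
      continuous_invFun := by fun_prop }
  let e₁ := AddCircle.homeomorphCircle H.pos.ne'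
  let e₂ := AddCircle.homeomorphCircle ha
  refine ⟨((e₁.symm.prodCongr e₂.symm).trans shear).trans h, fun c => ?_⟩
  obtain ⟨b, hb⟩ := QuotientAddGroup.mk_surjective (e₁.symm c)
  have hcurve : ∀ t, curve T (fun t => t + b) (fun t => position q a (t + b) (t + 0))
      (fun t => velocity r a (t + b) (t + 0)) t =
        torusMap H R (R.proj (t : AddCircle (4 * a)) + e₁.symm c, (t : AddCircle (4 * a))) := by
    intro t
    rw [← hb, curve, add_zero]
    exact (torusMap_coe H R (t + b) t).symm
  refine ⟨_, _, _, isSolutionOn_position H R b 0, ae_position_ne_zero H R b 0,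
    ⟨4 * a, by linarith [R.pos H], fun t => ?_⟩, ?_⟩
  · rw [hcurve, hcurve, AddCircle.coe_add_period]
  · rw [funext hcurve]
    ext z
    constructor
    · rintro ⟨d, rfl⟩
      obtain ⟨t, ht⟩ := QuotientAddGroup.mk_surjective (e₂.symm d)
      refine ⟨t, ?_⟩
      change torusMap H R (R.proj (t : AddCircle (4 * a)) + e₁.symm c, (t : AddCircle (4 * a))) =
        (h (R.proj (e₂.symm d) + e₁.symm c, e₂.symm d) : Phase T)
      rw [hh, ← ht]
    · rintro ⟨t, rfl⟩
      refine ⟨e₂ (t : AddCircle (4 * a)), ?_⟩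
      change (h (R.proj (e₂.symm (e₂ t)) + e₁.symm c, e₂.symm (e₂ t)) : Phase T) = _
      rw [hh, e₂.symm_apply_apply]

lemma closedRegion_subset_openRegion (H : IsPeriodicPrimitive T p r q L) {a' : ℝ}
    (hL : 2 * L < a) (haa' : a < a') :
    closedRegion H.velLift H.posLift a ⊆ openRegion H.velLift H.posLift a' := by
  rintro ⟨θ, x, y⟩ ⟨h1, h2, h3⟩
  obtain ⟨t, rfl⟩ := QuotientAddGroup.mk_surjective θ
  set v := y - H.velLift (t : AddCircle T) with hv
  have hq : ∀ s s' : ℝ, |s - s'| = a' - a → |q s - q s'| < (a' ^ 2 - a ^ 2) / 2 := by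
    intro s s' hs
    have h4 := H.abs_sub_le s' s
    rw [hs] at h4
    have h0 := H.bound_nonneg
    nlinarith
  have hd : |a' - a| = a' - a := abs_of_pos (by linarith)
  refine ⟨h1.trans_lt haa', lt_of_lt_of_le ?_ h2, lt_of_le_of_lt h3 ?_⟩
  · change q t - q (t - (v - a')) - (a' ^ 2 - v ^ 2) / 2 <
      q t - q (t - (v - a)) - (a ^ 2 - v ^ 2) / 2
    have := abs_lt.1 (hq (t - (v - a')) (t - (v - a)) (by rw [← hd]; congr 1; ring))
    linarith [this.1]
  · change q t - q (t - (a - v)) + (a ^ 2 - v ^ 2) / 2 <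
      q t - q (t - (a' - v)) + (a' ^ 2 - v ^ 2) / 2
    have := abs_lt.1 (hq (t - (a - v)) (t - (a' - v)) (by rw [← hd]; congr 1; ring))
    linarith [this.2]

lemma exists_forall_mem_openRegion {Rv Q : AddCircle T → ℝ} (hT : 0 < T) (hQ : Continuous Q)
    (z : Phase T) : ∃ A : ℝ, ∀ a, A < a → z ∈ openRegion Rv Q a := by
  obtain ⟨M, hM⟩ := exists_abs_le_of_continuous hT hQ
  obtain ⟨θ, x, y⟩ := z
  set v := y - Rv θ with hv
  refine ⟨v ^ 2 + 2 * |x| + 4 * M + 1, fun a ha => ?_⟩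
  have hM0 : 0 ≤ M := (abs_nonneg _).trans (hM θ)
  have hx := abs_nonneg x
  have hv0 := sq_nonneg v
  have k1 := abs_le.1 (hM θ)
  have k2 := abs_le.1 (hM (θ - ((a - v : ℝ) : AddCircle T)))
  have k3 := abs_le.1 (hM (θ - ((v - a : ℝ) : AddCircle T)))
  have k4 : a ≤ a ^ 2 := by nlinarith
  refine ⟨?_, ?_, ?_⟩
  · change |v| < a
    nlinarith [sq_nonneg (|v| - 1), sq_abs v]
  · change Q θ - Q (θ - ((v - a : ℝ) : AddCircle T)) - (a ^ 2 - v ^ 2) / 2 < x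
    linarith [neg_abs_le x]
  · change x < Q θ - Q (θ - ((a - v : ℝ) : AddCircle T)) + (a ^ 2 - v ^ 2) / 2
    linarith [le_abs_self x]

end Properties

end NonsmoothOscillator

open NonsmoothOscillator in
theorem theoremA (T : ℝ) (hT : 0 < T) (p : ℝ → ℝ) (hper : Function.Periodic p T)
    (hint : IntervalIntegrable p MeasureTheory.volume 0 T) (havg : ∫ t in (0 : ℝ)..T, p t = 0) :
    ∃ K : ℕ → Set (NonsmoothOscillator.Phase T),
      (∀ n, NonsmoothOscillator.IsTorus T (K n) ∧ NonsmoothOscillator.IsInvariant T p (K n)) ∧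
      (∀ n, K n ∪ NonsmoothOscillator.enclosed T (K n) ⊆
        NonsmoothOscillator.enclosed T (K (n + 1))) ∧
      (⋃ n, NonsmoothOscillator.enclosed T (K n)) = Set.univ ∧
      (∀ n, NonsmoothOscillator.IsFoliatedByPeriodicSolutions T p (K n)) := by
  obtain ⟨r, q, L, H⟩ := exists_isPeriodicPrimitive hT hper hint havg
  -- the first tori may fail to exist: the free oscillation has to be faster than the forcing
  obtain ⟨N, hN⟩ := exists_nat_gt (4 * L / T)
  rw [div_lt_iff₀ hT] at hN
  let a : ℕ → ℝ := fun n => (n + N : ℕ) * T / 2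
  have ha : ∀ n, IsResonant T L (a n) := fun n => by
    refine ⟨⟨n + N, by simp only [a]; ring⟩, ?_⟩
    have h1 : 0 ≤ (n : ℝ) * T := by positivity
    simp only [a]
    push_cast
    linarith
  have hstep : ∀ n, a n < a (n + 1) := fun n => by
    simp only [a]
    push_cast
    linarith
  have henc := fun n => enclosed_torus (a := a n) hT H.continuous_velLift H.continuous_posLift
  refine ⟨fun n => torus H.velLift H.posLift (a n),
    fun n => ⟨isTorus_torus H (ha n), isInvariant_torus H (ha n)⟩, fun n => ?_, ?_,
    fun n => isFoliatedByPeriodicSolutions_torus H (ha n)⟩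
  · rw [henc, henc]
    exact (Set.union_subset Set.sdiff_subset openRegion_subset_closedRegion).trans
      (closedRegion_subset_openRegion H (ha n).lt (hstep n))
  · rw [Set.eq_univ_iff_forall]
    intro z
    obtain ⟨A, hA⟩ := exists_forall_mem_openRegion (Rv := H.velLift) hT H.continuous_posLift z
    obtain ⟨n, hn⟩ := exists_nat_gt (2 * A / T)
    rw [div_lt_iff₀ hT] at hn
    refine Set.mem_iUnion.2 ⟨n, ?_⟩
    rw [henc]
    refine hA _ ?_
    have h1 : 0 ≤ (N : ℝ) * T := by positivity
    simp only [a]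
    push_cast
    linarith
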